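/- Let $\Omega$ be a nonempty set and $z_0\in\Omega$. Let $s$ be a normalized complete Nevanlinna--Pick kernel on $\Omega$ (normalized at $z_0$), i.e. a positive definite kernel of the form $$s_w(z)=\frac{1}{1-\sum_{n=1}^\infty u_n(z)\overline{u_n(w)}},\qquad z,w\in\Omega,$$ where $u_n:\Omega\to\mathbb C$ satisfy $u_n(z_0)=0$ for all $n$ and $\sum_n|u_n(z)|^2<\infty$ for all $z\in\Omega$. Let $g_n:\Omega\to\mathbb C$, $n\ge 0$, be such that $$g_w(z)=\sum_{n=0}^\infty g_n(z)\overline{g_n(w)}$$ converges for all $z,w\in\Omega$, and let $k_w(z)=s_w(z)g_w(z)$. Denote by $\mathcal H_s$ and $\mathcal H_k$ the Hilbert spaces of functions on $\Omega$ with reproducing kernels $s$ and $k$, and by $\mathrm{Mult}(\mathcal H_s)$ the set of functions $\varphi:\Omega\to\mathbb C$ for which $h\mapsto\varphi h$ is a bounded linear operator on $\mathcal H_s$. Then a function $f:\Omega\to\mathbb C$ belongs to the closed unit ball of $\mathcal H_k$ (that is, $f\in\mathcal H_k$ and $\|f\|_{\mathcal H_k}\le 1$) if and only if there exist $\psi\in\mathrm{Mult}(\mathcal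 H_s)$ and $\varphi_n\in\mathrm{Mult}(\mathcal H_s)$, $n\ge 0$, with $\psi(z_0)=0$ and $$\|\psi h\|_{\mathcal H_s}^2+\sum_{n=0}^\infty\|\varphi_n h\|_{\mathcal H_s}^2\le\|h\|_{\mathcal H_s}^2\qquad\text{for all }h\in\mathcal H_s,$$ such that for every $z\in\Omega$ one has $\psi(z)\ne 1$, the series $\sum_n g_n(z)\varphi_n(z)$ converges absolutely, and $$f(z)=\frac{\sum_{n=0}^\infty g_n(z)\varphi_n(z)}{1-\psi(z)}.$$ -/

import Mathlib

open ComplexConjugate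
open scoped ComplexOrder

/-- The scalar reproducing kernel `k_w(z) = ⟪k_w, k_z⟫` (inner product linear in
the first slot) of a Hilbert space `H` of complex functions on `Ω`; that is, `k_w(z)` is the value
at `z` of the element `k_w` of `H` that represents evaluation at `w`. -/
noncomputable def scalarKernel {Ω : Type*} (H : Type*) [NormedAddCommGroup H]
    [InnerProductSpace ℂ H] [CompleteSpace H] [RKHS ℂ H Ω ℂ] (z w : Ω) : ℂ :=
  RKHS.kernel H z w 1

/-- `s` (written `s z w` for `s_w(z)`) is a normalized complete Nevanlinna–Pick kernel with
normalization point `z₀`: it is a positive definite kernel of the form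
`s_w(z) = 1 / (1 - ∑ n, u_n(z) * conj (u_n(w)))`, where `u z = (u_n(z))_n` is a (row) vector of
`ℓ²` for every `z`, and `u_n(z₀) = 0` for all `n`. -/
def IsNormalizedCNP {Ω : Type*} (s : Ω → Ω → ℂ) (z₀ : Ω) : Prop :=
  (Matrix.of s).PosSemidef ∧
  ∃ u : ℕ → Ω → ℂ, (∀ n, u n z₀ = 0) ∧ (∀ z, Summable fun n => ‖u n z‖ ^ 2) ∧
    ∀ z w, 1 - ∑' n, u n z * conj (u n w) ≠ 0 ∧
      s z w = 1 / (1 - ∑' n, u n z * conj (u n w))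

/-- `φ` is a multiplier of the Hilbert function space `H`: pointwise multiplication by `φ` is a
bounded linear operator from `H` to `H`. -/
def IsMultiplier {Ω : Type*} (H : Type*) [NormedAddCommGroup H]
    [InnerProductSpace ℂ H] [RKHS ℂ H Ω ℂ] (φ : Ω → ℂ) : Prop :=
  ∃ T : H →L[ℂ] H, ∀ (h : H) (z : Ω), T h z = φ z * h z

/-- The set `Mult(H)` of multipliers of `H`, as a type. -/
def Mult {Ω : Type*} (H : Type*) [NormedAddCommGroup H]
    [InnerProductSpace ℂ H] [RKHS ℂ H Ω ℂ] : Type _ :=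
  {φ : Ω → ℂ // IsMultiplier H φ}

/-- The operator `h ↦ φ h` of multiplication by a multiplier `φ`. -/
noncomputable def Mult.op {Ω : Type*} {H : Type*} [NormedAddCommGroup H]
    [InnerProductSpace ℂ H] [RKHS ℂ H Ω ℂ] (φ : Mult H) : H →L[ℂ] H :=
  φ.2.choose

/-- `φ.op h` is the pointwise product `φ h`; an element of `H` is determined by its values, so
this determines `φ.op`. -/
theorem Mult.op_apply {Ω : Type*} {H : Type*} [NormedAddCommGroup H]
    [InnerProductSpace ℂ H] [RKHS ℂ H Ω ℂ] (φ : Mult H) (h : H) (z : Ω) :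
    φ.op h z = φ.1 z * h z :=
  φ.2.choose_spec h z

/-- The function `f` belongs to the (closed) unit ball of the Hilbert function space `H`. -/
def InUnitBall {Ω : Type*} (H : Type*) [NormedAddCommGroup H]
    [InnerProductSpace ℂ H] [RKHS ℂ H Ω ℂ] (f : Ω → ℂ) : Prop :=
  ∃ F : H, (∀ z, F z = f z) ∧ ‖F‖ ≤ 1

/-! Both directions turn kernel identities into contractions acting on kernel vectors. Write `s_w`,
`k_w` for these vectors, and `U w`, `G w` for the conjugated sequences `u(w)`, `gn(w)` in `ℓ²`.

Sufficiency. The map `k_w ↦ G w ⊗ s_w` is isometric, so its adjoint sends the unit ball of `ℓ²(Hs)`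
into that of `Hk` by `(hₙ) ↦ ∑ gₙ hₙ` (`inUnitBall_tsum_mul`). Apply it to `hₙ = φₙ h` with `h = (1
- rψ)⁻¹ 1`. Since `ψ(z₀) = 0`, the constant `1 = s_{z₀}` is orthogonal to `ψ h`, so `‖h‖² ≤ 1 + ‖ψ
h‖²`, and the column inequality leaves `∑ ‖φₙ h‖² ≤ 1`. Then let `r → 1`.

Necessity (`exists_factorization`). The identity `k = ⟪U, U⟫ k + g` gives a contraction `V` with `V
(U w ⊗ k_w, G w) = k_w`. Given `F` in the ball, feed an input `(α, v)` into `x = V (U w ⊗ (x + (α -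
⟪F, x⟫) F), v)` and read off `⟪F, x⟫`. The conjugated outputs on the standard basis of `ℂ ⊕ ℓ²` are
`ψ(w)` and `φₙ(w)`. The input `(conj (F w), G w)` has solution `k_w` and returns `conj (F w)`; by
linearity this is `F (1 - ψ) = ∑ gₙ φₙ`. Contractivity of the column is
`posSemidef_kernel_hadamard_sub`, an application of the Schur product theorem. -/

open scoped InnerProductSpace Matrix

/-! ### Gram matrix inequalities and contractions -/

section GramMatrices

variable {I X Y : Type*} [NormedAddCommGroup X] [InnerProductSpace ℂ X]
  [NormedAddCommGroup Y] [InnerProductSpace ℂ Y]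

theorem finsupp_sum_inner_eq_norm_sq (a : I → X) (c : I →₀ ℂ) :
    (c.sum fun i x => c.sum fun j y => star x * ⟪a i, a j⟫_ℂ * y) =
      ((‖Finsupp.linearCombination ℂ a c‖ ^ 2 : ℝ) : ℂ) := by
  have hn : ((‖Finsupp.linearCombination ℂ a c‖ ^ 2 : ℝ) : ℂ) =
      ⟪Finsupp.linearCombination ℂ a c, Finsupp.linearCombination ℂ a c⟫_ℂ := by
    rw [inner_self_eq_norm_sq_to_K, Complex.ofReal_pow]
    rfl
  rw [hn, Finsupp.linearCombination_apply, Finsupp.sum_inner]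
  refine Finsupp.sum_congr fun i _ => ?_
  rw [Finsupp.inner_sum]
  refine Finsupp.sum_congr fun j _ => ?_
  simp only [inner_smul_left, inner_smul_right, starRingEnd_apply]
  ring

theorem posSemidef_gram_of_infinite (a : I → X) : (Matrix.gram ℂ a).PosSemidef := by
  refine ⟨Matrix.isHermitian_gram ℂ a, fun c => ?_⟩
  simp only [Matrix.gram_apply]
  rw [finsupp_sum_inner_eq_norm_sq]
  exact Complex.zero_le_real.2 (sq_nonneg _)

theorem posSemidef_gram_sub_gram_iff (a : I → X) (b : I → Y) :
    (Matrix.gram ℂ a - Matrix.gram ℂ b).PosSemidef ↔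
      ∀ c : I →₀ ℂ, ‖Finsupp.linearCombination ℂ b c‖ ≤ ‖Finsupp.linearCombination ℂ a c‖ := by
  have key : ∀ c : I →₀ ℂ, (c.sum fun i x => c.sum fun j y =>
      star x * (Matrix.gram ℂ a - Matrix.gram ℂ b) i j * y) =
      ((‖Finsupp.linearCombination ℂ a c‖ ^ 2 - ‖Finsupp.linearCombination ℂ b c‖ ^ 2 : ℝ) : ℂ) := by
    intro c
    rw [Complex.ofReal_sub, ← finsupp_sum_inner_eq_norm_sq, ← finsupp_sum_inner_eq_norm_sq]
    simp only [Matrix.sub_apply, Matrix.gram_apply, mul_sub, sub_mul, Finsupp.sum_sub]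
  constructor
  · intro h c
    have := h.2 c
    rw [key, Complex.zero_le_real, sub_nonneg] at this
    exact (sq_le_sq₀ (norm_nonneg _) (norm_nonneg _)).1 this
  · intro h
    refine ⟨(Matrix.isHermitian_gram ℂ a).sub (Matrix.isHermitian_gram ℂ b), fun c => ?_⟩
    rw [key, Complex.zero_le_real, sub_nonneg]
    exact (sq_le_sq₀ (norm_nonneg _) (norm_nonneg _)).2 (h c)

/-- The bound makes the assignment well defined and contractive on the span of the `a i`; it extends
to the closed span by density and by zero to the orthogonal complement. -/
theorem exists_contraction_of_norm_linearCombination_le [CompleteSpace X] [CompleteSpace Y]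
    (a : I → X) (b : I → Y)
    (h : ∀ c : I →₀ ℂ, ‖Finsupp.linearCombination ℂ b c‖ ≤ ‖Finsupp.linearCombination ℂ a c‖) :
    ∃ R : X →L[ℂ] Y, ‖R‖ ≤ 1 ∧ ∀ i, R (a i) = b i := by
  let La := Finsupp.linearCombination ℂ a
  let Lb := Finsupp.linearCombination ℂ b
  let K : Submodule ℂ X := (LinearMap.range La).topologicalClosure
  have : CompleteSpace K :=
    (Submodule.isClosed_topologicalClosure _).completeSpace_coe
  let e : (I →₀ ℂ) →ₗ[ℂ] K :=
    La.codRestrict K fun c => Submodule.le_topologicalClosure _ (LinearMap.mem_range_self _ c)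
  have he : DenseRange e := by
    intro x
    rw [closure_subtype]
    have hx : (x : X) ∈ closure (LinearMap.range La : Set X) := x.2
    convert hx using 2
    ext y
    simp only [Set.mem_image, Set.mem_range, SetLike.mem_coe, LinearMap.mem_range]
    constructor
    · rintro ⟨_, ⟨c, rfl⟩, rfl⟩
      exact ⟨c, rfl⟩
    · rintro ⟨c, rfl⟩
      exact ⟨_, ⟨c, rfl⟩, rfl⟩
  have hn : ∀ c, ‖Lb c‖ ≤ 1 * ‖e c‖ := fun c => by
    rw [one_mul]; exact h c
  refine ⟨(Lb.extendOfNorm e).comp K.orthogonalProjectionOnto, ?_, fun i => ?_⟩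
  · refine (ContinuousLinearMap.opNorm_comp_le _ _).trans ?_
    exact mul_le_one₀ (LinearMap.opNorm_extendOfNorm_le he zero_le_one hn) (norm_nonneg _)
      K.orthogonalProjectionOnto_norm_le
  · have hai : a i = (e (Finsupp.single i 1) : X) := by simp [e, La]
    rw [ContinuousLinearMap.comp_apply, hai, Submodule.orthogonalProjectionOnto_mem_subspace_eq_self,
      LinearMap.extendOfNorm_eq he ⟨1, hn⟩]
    simp [Lb]

theorem exists_contraction_of_posSemidef_gram_sub_gram [CompleteSpace X] [CompleteSpace Y]
    (a : I → X) (b : I → Y) (h : (Matrix.gram ℂ a - Matrix.gram ℂ b).PosSemidef) :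
    ∃ R : X →L[ℂ] Y, ‖R‖ ≤ 1 ∧ ∀ i, R (a i) = b i :=
  exists_contraction_of_norm_linearCombination_le a b ((posSemidef_gram_sub_gram_iff a b).1 h)

theorem exists_contraction_of_inner_eq [CompleteSpace X] [CompleteSpace Y]
    (a : I → X) (b : I → Y) (h : ∀ i j, ⟪a i, a j⟫_ℂ = ⟪b i, b j⟫_ℂ) :
    ∃ R : X →L[ℂ] Y, ‖R‖ ≤ 1 ∧ ∀ i, R (a i) = b i := by
  refine exists_contraction_of_posSemidef_gram_sub_gram a b ?_
  have : Matrix.gram ℂ a = Matrix.gram ℂ b := Matrix.ext h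
  rw [this, sub_self]
  exact Matrix.PosSemidef.zero

end GramMatrices

/-! ### The Hilbert tensor product with `ℓ²` -/

section SequenceTensor

variable {H : Type*} [NormedAddCommGroup H] [InnerProductSpace ℂ H]

/-- The elementary tensor `a ⊗ y`, realised as the square-summable sequence `n ↦ a n • y`. -/
noncomputable def lpTensor (a : lp (fun _ : ℕ => ℂ) 2) : H →ₗ[ℂ] lp (fun _ : ℕ => H) 2 where
  toFun y := ⟨fun n => a n • y, by
    refine memℓp_gen ?_
    have ha := (lp.memℓp a).summable (by norm_num)
    simpa [norm_smul, mul_pow] using ha.mul_right (‖y‖ ^ 2)⟩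
  map_add' x y := lp.ext (funext fun n => smul_add (a n) x y)
  map_smul' c y := lp.ext (funext fun n => smul_comm (a n) c y)

@[simp]
theorem lpTensor_apply (a : lp (fun _ : ℕ => ℂ) 2) (y : H) (n : ℕ) :
    lpTensor a y n = a n • y := rfl

theorem inner_lpTensor (a b : lp (fun _ : ℕ => ℂ) 2) (x y : H) :
    ⟪lpTensor a x, lpTensor b y⟫_ℂ = ⟪a, b⟫_ℂ * ⟪x, y⟫_ℂ := by
  rw [lp.inner_eq_tsum, lp.inner_eq_tsum, ← tsum_mul_right]
  refine tsum_congr fun n => ?_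
  simp only [lpTensor_apply, inner_smul_left, inner_smul_right, RCLike.inner_apply]
  ring

theorem norm_lpTensor (a : lp (fun _ : ℕ => ℂ) 2) (x : H) :
    ‖lpTensor a x‖ = ‖a‖ * ‖x‖ := by
  have h := inner_lpTensor a a x x
  rw [inner_self_eq_norm_sq_to_K, inner_self_eq_norm_sq_to_K, inner_self_eq_norm_sq_to_K,
    ← mul_pow] at h
  have h' : ‖lpTensor a x‖ ^ 2 = (‖a‖ * ‖x‖) ^ 2 := by exact_mod_cast h
  exact (sq_eq_sq₀ (norm_nonneg _) (by positivity)).1 h'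

end SequenceTensor

/-! ### Kernel vectors and the unit ball of a reproducing kernel space -/

section FunctionSpaces

variable {Ω : Type*} (H : Type*) [NormedAddCommGroup H] [InnerProductSpace ℂ H] [CompleteSpace H]
  [RKHS ℂ H Ω ℂ]

/-- The element of `H` representing evaluation at `w`. -/
noncomputable def kernelVector (w : Ω) : H := RKHS.kerFun H w 1

variable {H}

theorem inner_kernelVector_left (w : Ω) (F : H) : ⟪kernelVector H w, F⟫_ℂ = F w := by
  rw [kernelVector, RKHS.kerFun_inner]
  simp

theorem inner_kernelVector_right (w : Ω) (F : H) : ⟪F, kernelVector H w⟫_ℂ = conj (F w) := by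
  rw [← inner_conj_symm, inner_kernelVector_left]

theorem kernelVector_apply (w z : Ω) : kernelVector H w z = scalarKernel H z w := by
  rw [kernelVector, RKHS.kerFun_apply, scalarKernel]

theorem inner_kernelVector (z w : Ω) :
    ⟪kernelVector H z, kernelVector H w⟫_ℂ = scalarKernel H z w := by
  rw [inner_kernelVector_left, kernelVector_apply]

/-- Every contractive functional on the kernel vectors comes from the unit ball of `H`. -/
theorem inUnitBall_of_norm_linearCombination_le (f : Ω → ℂ)
    (h : ∀ c : Ω →₀ ℂ, ‖Finsupp.linearCombination ℂ (fun w => conj (f w)) c‖ ≤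
      ‖Finsupp.linearCombination ℂ (kernelVector H) c‖) : InUnitBall H f := by
  obtain ⟨R, hR, hRk⟩ := exists_contraction_of_norm_linearCombination_le _ _ h
  refine ⟨R.adjoint 1, fun z => ?_, ?_⟩
  · rw [← inner_kernelVector_left, ContinuousLinearMap.adjoint_inner_right, hRk]
    simp
  · refine (R.adjoint.le_opNorm 1).trans ?_
    simpa using hR

theorem norm_linearCombination_conj_le (F : H) (hF : ‖F‖ ≤ 1) (c : Ω →₀ ℂ) :
    ‖Finsupp.linearCombination ℂ (fun w => conj (F w)) c‖ ≤
      ‖Finsupp.linearCombination ℂ (kernelVector H) c‖ := by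
  have : Finsupp.linearCombination ℂ (fun w => conj (F w)) c =
      ⟪F, Finsupp.linearCombination ℂ (kernelVector H) c⟫_ℂ := by
    rw [Finsupp.linearCombination_apply, Finsupp.linearCombination_apply, Finsupp.inner_sum]
    simp [inner_smul_right, inner_kernelVector_right]
  rw [this]
  exact (norm_inner_le_norm _ _).trans (mul_le_of_le_one_left (norm_nonneg _) hF)

/-- The unit ball of `H` is closed under pointwise limits. -/
theorem inUnitBall_of_tendsto {ι : Type*} {l : Filter ι} [l.NeBot] {F : ι → Ω → ℂ} {f : Ω → ℂ}
    (hF : ∀ᶠ i in l, InUnitBall H (F i))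
    (hlim : ∀ z, Filter.Tendsto (fun i => F i z) l (nhds (f z))) : InUnitBall H f := by
  -- For fixed `c` the criterion involves only finitely many values of `f`, so it survives pointwise
  -- limits.
  refine inUnitBall_of_norm_linearCombination_le f fun c => ?_
  have ht : Filter.Tendsto
      (fun i => ‖Finsupp.linearCombination ℂ (fun w => conj (F i w)) c‖) l
      (nhds ‖Finsupp.linearCombination ℂ (fun w => conj (f w)) c‖) := by
    simp only [Finsupp.linearCombination_apply, Finsupp.sum]
    refine (tendsto_finsetSum _ fun w _ => ?_).norm
    exact ((Complex.continuous_conj.tendsto _).comp (hlim w)).const_smul (c w)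
  refine le_of_tendsto ht (hF.mono ?_)
  rintro i ⟨G, hG, hG1⟩
  have := norm_linearCombination_conj_le G hG1 c
  simpa only [hG] using this

end FunctionSpaces

/-! ### The factorization `k = s g` as an isometry -/

section FactorKernel

variable {Ω : Type*}
  {Hs : Type*} [NormedAddCommGroup Hs] [InnerProductSpace ℂ Hs] [CompleteSpace Hs] [RKHS ℂ Hs Ω ℂ]
  {Hk : Type*} [NormedAddCommGroup Hk] [InnerProductSpace ℂ Hk] [CompleteSpace Hk] [RKHS ℂ Hk Ω ℂ]

/-- The `ℓ²` sequence attached to a square-summable complex sequence. -/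
noncomputable def toL2 (a : ℕ → ℂ) (ha : Summable fun n => ‖a n‖ ^ 2) :
    lp (fun _ : ℕ => ℂ) 2 :=
  ⟨a, memℓp_gen (by simpa using ha)⟩

@[simp]
theorem toL2_apply (a : ℕ → ℂ) (ha : Summable fun n => ‖a n‖ ^ 2) (n : ℕ) :
    toL2 a ha n = a n := rfl

/-- The sequences are conjugated because the inner product is conjugate-linear in its first slot. -/
theorem inner_toL2_conj {a b : ℕ → ℂ} (ha : Summable fun n => ‖conj (a n)‖ ^ 2)
    (hb : Summable fun n => ‖conj (b n)‖ ^ 2) :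
    ⟪toL2 _ ha, toL2 _ hb⟫_ℂ = ∑' n, a n * conj (b n) := by
  rw [lp.inner_eq_tsum]
  refine tsum_congr fun n => ?_
  simp [mul_comm]

theorem summable_norm_sq_conj_of_hasSum {a : ℕ → ℂ} {g : ℂ}
    (h : HasSum (fun n => a n * conj (a n)) g) : Summable fun n => ‖conj (a n)‖ ^ 2 := by
  have := h.summable.norm
  simpa [sq] using this

theorem inUnitBall_tsum_mul {gn : ℕ → Ω → ℂ}
    (hg : ∀ z, Summable fun n => ‖conj (gn n z)‖ ^ 2)
    (hk : ∀ z w, scalarKernel Hk z w = scalarKernel Hs z w * ∑' n, gn n z * conj (gn n w))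
    (h : lp (fun _ : ℕ => Hs) 2) (hh : ‖h‖ ≤ 1) :
    InUnitBall Hk fun z => ∑' n, gn n z * h n z := by
  obtain ⟨R, hR, hRk⟩ := exists_contraction_of_inner_eq (fun w => kernelVector Hk w)
    (fun w => lpTensor (toL2 _ (hg w)) (kernelVector Hs w)) (by
      intro z w
      rw [inner_lpTensor, inner_toL2_conj, inner_kernelVector, inner_kernelVector, hk, mul_comm])
  refine ⟨R.adjoint h, fun z => ?_, ?_⟩
  · rw [← inner_kernelVector_left, ContinuousLinearMap.adjoint_inner_right, hRk,
      lp.inner_eq_tsum]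
    refine tsum_congr fun n => ?_
    simp [inner_smul_left, inner_kernelVector_left]
  · refine (R.adjoint.le_opNorm h).trans ?_
    rw [LinearIsometryEquiv.norm_map]
    exact mul_le_one₀ hR (norm_nonneg _) hh

end FactorKernel

/-! ### Sufficiency -/

section FactorKernel

variable {Ω : Type*}
  {Hs : Type*} [NormedAddCommGroup Hs] [InnerProductSpace ℂ Hs] [CompleteSpace Hs] [RKHS ℂ Hs Ω ℂ]
  {Hk : Type*} [NormedAddCommGroup Hk] [InnerProductSpace ℂ Hk] [CompleteSpace Hk] [RKHS ℂ Hk Ω ℂ]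

/-- If the column `(ψ, φ₀, φ₁, …)` is contractive, `ψ z₀ = 0` and the kernel is normalized at `z₀`,
then `∑ gₙ φₙ / (1 - r ψ)` lies in the unit ball for `0 ≤ r < 1`. -/
theorem inUnitBall_div_one_sub_mul {z₀ : Ω} {gn : ℕ → Ω → ℂ}
    (hg : ∀ z, Summable fun n => ‖conj (gn n z)‖ ^ 2)
    (hk : ∀ z w, scalarKernel Hk z w = scalarKernel Hs z w * ∑' n, gn n z * conj (gn n w))
    (hz₀ : ∀ z, scalarKernel Hs z z₀ = 1) (ψ : Mult Hs) (φ : ℕ → Mult Hs) (hψ : ψ.1 z₀ = 0)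
    (hc : ∀ h : Hs, Summable (fun n => ‖(φ n).op h‖ ^ 2) ∧
      ‖ψ.op h‖ ^ 2 + ∑' n, ‖(φ n).op h‖ ^ 2 ≤ ‖h‖ ^ 2) {r : ℝ} (hr0 : 0 ≤ r) (hr1 : r < 1) :
    InUnitBall Hk fun z => (∑' n, gn n z * (φ n).1 z) / (1 - r * ψ.1 z) := by
  have hone : ∀ z, kernelVector Hs z₀ z = 1 := fun z => by rw [kernelVector_apply, hz₀]
  have hψn : ‖ψ.op‖ ≤ 1 := ψ.op.opNorm_le_bound zero_le_one fun h => by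
    rw [one_mul]
    refine (sq_le_sq₀ (norm_nonneg _) (norm_nonneg _)).1 (le_trans ?_ (hc h).2)
    exact le_add_of_nonneg_right (tsum_nonneg fun n => sq_nonneg _)
  have hA : ‖(r : ℂ) • ψ.op‖ < 1 := by
    rw [norm_smul, Complex.norm_real, Real.norm_of_nonneg hr0]
    nlinarith [norm_nonneg ψ.op]
  let E := Units.oneSub _ hA
  let h : Hs := (↑E⁻¹ : Hs →L[ℂ] Hs) (kernelVector Hs z₀)
  have hh : h - (r : ℂ) • ψ.op h = kernelVector Hs z₀ := by
    have h1 : (E : Hs →L[ℂ] Hs) ((↑E⁻¹ : Hs →L[ℂ] Hs) (kernelVector Hs z₀)) =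
        kernelVector Hs z₀ := by
      rw [← mul_apply_eq_comp, Units.mul_inv, one_apply_eq_self]
    rw [← h1]
    simp [E, h]
  have hval : ∀ z, h z * (1 - r * ψ.1 z) = 1 := fun z => by
    have := congrArg (fun F : Hs => F z) hh
    simp only [RKHS.coe_sub, RKHS.coe_smul, Pi.sub_apply, Pi.smul_apply, Mult.op_apply, hone,
      smul_eq_mul] at this
    linear_combination this
  have hnorm : ‖h‖ ^ 2 ≤ 1 + ‖ψ.op h‖ ^ 2 := by
    have hh' : h = kernelVector Hs z₀ + (r : ℂ) • ψ.op h := by rw [← hh]; abel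
    -- Orthogonality to the constant `1 = s_{z₀}` means vanishing at `z₀`; this permits Pythagoras.
    have h0 : ⟪kernelVector Hs z₀, (r : ℂ) • ψ.op h⟫_ℂ = 0 := by
      rw [inner_smul_right, inner_kernelVector_left, Mult.op_apply, hψ]
      simp
    have h1 : ‖kernelVector Hs z₀‖ ^ 2 = 1 := by
      have : ((‖kernelVector Hs z₀‖ ^ 2 : ℝ) : ℂ) = 1 := by
        rw [← hone z₀, ← inner_kernelVector_left, inner_self_eq_norm_sq_to_K, Complex.ofReal_pow]
        rfl
      exact_mod_cast this
    have h2 := norm_add_sq_eq_norm_sq_add_norm_sq_of_inner_eq_zero _ _ h0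
    rw [← hh', norm_smul, Complex.norm_real, Real.norm_of_nonneg hr0] at h2
    have h3 : r * ‖ψ.op h‖ ≤ ‖ψ.op h‖ := mul_le_of_le_one_left (norm_nonneg _) hr1.le
    have h4 : 0 ≤ r * ‖ψ.op h‖ := by positivity
    nlinarith
  have hsum : ∑' n, ‖(φ n).op h‖ ^ 2 ≤ 1 := by linarith [(hc h).2]
  let v : lp (fun _ : ℕ => Hs) 2 :=
    ⟨fun n => (φ n).op h, memℓp_gen (by simpa using (hc h).1)⟩
  have hv : ‖v‖ ≤ 1 := by
    have := lp.norm_rpow_eq_tsum (p := 2) (by norm_num) v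
    have h2 : ‖v‖ ^ 2 = ∑' n, ‖(φ n).op h‖ ^ 2 := by simpa using this
    nlinarith [norm_nonneg v]
  convert inUnitBall_tsum_mul hg hk v hv using 2 with z
  have hz : 1 / (1 - r * ψ.1 z) = h z := by
    have hne : (1 - r * ψ.1 z) ≠ 0 := fun h0 => by simpa [h0] using hval z
    rw [div_eq_iff hne, hval]
  rw [div_eq_mul_one_div, hz, ← tsum_mul_right]
  refine tsum_congr fun n => ?_
  change _ = gn n z * (φ n).op h z
  rw [Mult.op_apply]
  ring

/-- Multiplication by `ψ` may have norm one, so `1 - ψ` need not be invertible on `Hs`; the case `r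
< 1` is passed to the limit pointwise. -/
theorem inUnitBall_div_one_sub {z₀ : Ω} {gn : ℕ → Ω → ℂ}
    (hg : ∀ z, Summable fun n => ‖conj (gn n z)‖ ^ 2)
    (hk : ∀ z w, scalarKernel Hk z w = scalarKernel Hs z w * ∑' n, gn n z * conj (gn n w))
    (hz₀ : ∀ z, scalarKernel Hs z z₀ = 1) (ψ : Mult Hs) (φ : ℕ → Mult Hs) (hψ : ψ.1 z₀ = 0)
    (hc : ∀ h : Hs, Summable (fun n => ‖(φ n).op h‖ ^ 2) ∧
      ‖ψ.op h‖ ^ 2 + ∑' n, ‖(φ n).op h‖ ^ 2 ≤ ‖h‖ ^ 2) (hψ1 : ∀ z, 1 - ψ.1 z ≠ 0) :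
    InUnitBall Hk fun z => (∑' n, gn n z * (φ n).1 z) / (1 - ψ.1 z) := by
  refine inUnitBall_of_tendsto (l := nhdsWithin 1 (Set.Iio 1))
    (F := fun (r : ℝ) z => (∑' n, gn n z * (φ n).1 z) / (1 - r * ψ.1 z)) ?_ fun z => ?_
  · filter_upwards [Ioo_mem_nhdsLT (zero_lt_one (α := ℝ))] with r hr
    exact inUnitBall_div_one_sub_mul hg hk hz₀ ψ φ hψ hc hr.1.le hr.2
  · refine (Filter.Tendsto.div tendsto_const_nhds ?_ (hψ1 z)).mono_left nhdsWithin_le_nhds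
    have : Continuous fun r : ℝ => 1 - (r : ℂ) * ψ.1 z := by fun_prop
    simpa using this.tendsto 1

end FactorKernel

/-! ### The rank-one feedback and its fixed point equation -/

section RankOneDefect

variable {H : Type*} [NormedAddCommGroup H] [InnerProductSpace ℂ H]

/-- The right side exceeds the left by exactly `‖α - ⟪F, x⟫‖² (1 - ‖F‖²)`. -/
theorem norm_add_smul_sub_inner_sq_le {F : H} (hF : ‖F‖ ≤ 1) (x : H) (α : ℂ) :
    ‖x + (α - ⟪F, x⟫_ℂ) • F‖ ^ 2 + ‖⟪F, x⟫_ℂ‖ ^ 2 ≤ ‖α‖ ^ 2 + ‖x‖ ^ 2 := by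
  set t := ⟪F, x⟫_ℂ
  set β := α - t
  have hα : α = β + t := by simp [β]
  have h1 := norm_add_sq (𝕜 := ℂ) x (β • F)
  have h2 := norm_add_sq (𝕜 := ℂ) t β
  rw [inner_smul_right, ← inner_conj_symm, norm_smul, mul_pow] at h1
  rw [add_comm t β, ← hα, RCLike.inner_apply] at h2
  have h3 : ‖β‖ ^ 2 * ‖F‖ ^ 2 ≤ ‖β‖ ^ 2 :=
    mul_le_of_le_one_right (sq_nonneg _) (pow_le_one₀ (norm_nonneg _) hF)
  change _ = ‖x‖ ^ 2 + 2 * RCLike.re (β * conj t) + _ at h1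
  linarith

/-- The solution operator of the fixed point equation
`x = V (a ⊗ (x + (α - ⟪F, x⟫) F), v)` for a contraction `V` and `‖a‖ < 1`. -/
theorem exists_fixedPoint_solution [CompleteSpace H] {F : H} (hF : ‖F‖ ≤ 1)
    {E : Type*} [NormedAddCommGroup E] [InnerProductSpace ℂ E]
    (V : WithLp 2 (lp (fun _ : ℕ => H) 2 × E) →L[ℂ] H) (hV : ‖V‖ ≤ 1)
    {a : lp (fun _ : ℕ => ℂ) 2} (ha : ‖a‖ < 1) :
    ∃ X : (ℂ × E) →L[ℂ] H, ∀ (p : ℂ × E) (x : H),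
      x = X p ↔ x = V (WithLp.toLp 2 (lpTensor a (x + (p.1 - ⟪F, x⟫_ℂ) • F), p.2)) := by
  let V' : (lp (fun _ : ℕ => H) 2 × E) →L[ℂ] H :=
    V.comp (WithLp.prodContinuousLinearEquiv 2 ℂ _ _).symm.toContinuousLinearMap
  let T : H →L[ℂ] lp (fun _ : ℕ => H) 2 :=
    (lpTensor a).mkContinuous ‖a‖ fun y => (norm_lpTensor a y).le
  let P : H →L[ℂ] H := ContinuousLinearMap.id ℂ H - (innerSL ℂ F).smulRight F
  have hP : ∀ x, P x = x + (0 - ⟪F, x⟫_ℂ) • F := fun x => by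
    simp [P, sub_eq_add_neg]
  let B : H →L[ℂ] H := V'.comp ((ContinuousLinearMap.inl ℂ _ E).comp (T.comp P))
  -- The rank-one inequality at `α = 0` makes `P` a contraction, so `‖B‖ ≤ ‖a‖`, and `1 - B` is
  -- invertible by a Neumann series.
  have hB : ‖B‖ < 1 := by
    refine lt_of_le_of_lt (B.opNorm_le_bound (norm_nonneg a) fun x => ?_) ha
    have h1 : ‖B x‖ ≤ ‖WithLp.toLp 2 (lpTensor a (P x), (0 : E))‖ := by
      refine (V.le_opNorm _).trans (mul_le_of_le_one_left (norm_nonneg _) hV)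
    rw [WithLp.norm_toLp_fst, norm_lpTensor] at h1
    refine h1.trans (mul_le_mul_of_nonneg_left ?_ (norm_nonneg _))
    have h2 := norm_add_smul_sub_inner_sq_le hF x 0
    rw [← hP, norm_zero] at h2
    refine (sq_le_sq₀ (norm_nonneg _) (norm_nonneg _)).1 ?_
    nlinarith [sq_nonneg ‖⟪F, x⟫_ℂ‖]
  let D : (ℂ × E) →L[ℂ] lp (fun _ : ℕ => H) 2 × E :=
    ((ContinuousLinearMap.fst ℂ ℂ E).smulRight (T F)).prod (ContinuousLinearMap.snd ℂ ℂ E)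
  let U := Units.oneSub B hB
  refine ⟨(↑U⁻¹ : H →L[ℂ] H).comp (V'.comp D), fun p x => ?_⟩
  have hsplit : V (WithLp.toLp 2 (lpTensor a (x + (p.1 - ⟪F, x⟫_ℂ) • F), p.2)) =
      B x + V' (D p) := by
    have : V' (D p) + B x = V' (D p + (T (P x), 0)) := (map_add V' _ _).symm
    rw [add_comm (B x), this]
    change V' _ = V' _
    congr 1
    refine Prod.ext ?_ ?_
    · change T (x + (p.1 - ⟪F, x⟫_ℂ) • F) = p.1 • T F + T (P x)
      rw [hP, ← map_smul, ← map_add]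
      congr 1
      module
    · simp [D]
  rw [hsplit]
  constructor
  · intro h
    have : (U : H →L[ℂ] H) x = V' (D p) := by
      rw [h, ContinuousLinearMap.comp_apply, ← mul_apply_eq_comp, Units.mul_inv,
        one_apply_eq_self, ContinuousLinearMap.comp_apply]
    have h2 : (U : H →L[ℂ] H) x = x - B x := by simp [U]
    rw [← this, h2]
    abel
  · intro h
    have h2 : (U : H →L[ℂ] H) x = V' (D p) := by
      have h3 : (U : H →L[ℂ] H) x = x - B x := by simp [U]
      rw [h3, sub_eq_iff_eq_add']
      exact h
    rw [ContinuousLinearMap.comp_apply, ContinuousLinearMap.comp_apply, ← h2,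
      ← mul_apply_eq_comp, Units.inv_mul, one_apply_eq_self]

end RankOneDefect

/-! ### Positivity through the Schur product theorem -/

section SchurPositivity

variable {J : Type*}

theorem posSemidef_gram_sub_gram_map {X Y : Type*} [NormedAddCommGroup X] [InnerProductSpace ℂ X]
    [NormedAddCommGroup Y] [InnerProductSpace ℂ Y] (L : X →ₗ[ℂ] Y) (hL : ∀ x, ‖L x‖ ≤ ‖x‖)
    (a : J → X) : (Matrix.gram ℂ a - Matrix.gram ℂ fun j => L (a j)).PosSemidef := by
  refine (posSemidef_gram_sub_gram_iff _ _).2 fun c => ?_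
  have : Finsupp.linearCombination ℂ (fun j => L (a j)) c =
      L (Finsupp.linearCombination ℂ a c) :=
    (Finsupp.apply_linearCombination ℂ L a c).symm
  rw [this]
  exact hL _

/-- Write single letters for Gram matrices, with products entrywise. Since `p (1 - a) = 1`, the
matrix `p (α + v - φ)` equals `p (a (α + x - φ - m) + (a m + v - x)) + α + (x - φ)`. The three
differences are positive by the rank-one inequality, by contractivity of `V`, and by `‖F‖ ≤ 1`. -/
theorem posSemidef_kernel_hadamard_sub {H S E : Type*} [NormedAddCommGroup H]
    [InnerProductSpace ℂ H] [NormedAddCommGroup S] [InnerProductSpace ℂ S]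
    [NormedAddCommGroup E] [InnerProductSpace ℂ E] {F : H} (hF : ‖F‖ ≤ 1)
    (V : WithLp 2 (lp (fun _ : ℕ => H) 2 × E) →L[ℂ] H) (hV : ‖V‖ ≤ 1)
    (p : J → S) (a : J → lp (fun _ : ℕ => ℂ) 2)
    (hp : ∀ i j, ⟪p i, p j⟫_ℂ * (1 - ⟪a i, a j⟫_ℂ) = 1) (α : J → ℂ) (v : J → E) (x : J → H)
    (hx : ∀ j, x j = V (WithLp.toLp 2 (lpTensor (a j) (x j + (α j - ⟪F, x j⟫_ℂ) • F), v j))) :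
    (Matrix.gram ℂ p ⊙ (Matrix.gram ℂ α + Matrix.gram ℂ v - Matrix.gram ℂ fun j => ⟪F, x j⟫_ℂ)
      ).PosSemidef := by
  let m : J → H := fun j => x j + (α j - ⟪F, x j⟫_ℂ) • F
  let φ : J → ℂ := fun j => ⟪F, x j⟫_ℂ
  let L : WithLp 2 (ℂ × H) →ₗ[ℂ] WithLp 2 (H × ℂ) :=
    { toFun := fun y => WithLp.toLp 2 (y.snd + (y.fst - ⟪F, y.snd⟫_ℂ) • F, ⟪F, y.snd⟫_ℂ)
      map_add' := fun y z => by
        refine congrArg (WithLp.toLp 2) (Prod.ext ?_ ?_)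
        · simp only [WithLp.add_fst, WithLp.add_snd, inner_add_right]
          change _ = (y.snd + (y.fst - ⟪F, y.snd⟫_ℂ) • F) + (z.snd + (z.fst - ⟪F, z.snd⟫_ℂ) • F)
          module
        · exact inner_add_right _ _ _
      map_smul' := fun c y => by
        refine congrArg (WithLp.toLp 2) (Prod.ext ?_ ?_)
        · simp only [WithLp.smul_fst, WithLp.smul_snd, inner_smul_right, smul_eq_mul,
            RingHom.id_apply]
          change _ = c • (y.snd + (y.fst - ⟪F, y.snd⟫_ℂ) • F)
          module
        · exact inner_smul_right _ _ _ }
  have hdefect : (Matrix.gram ℂ α + Matrix.gram ℂ x - Matrix.gram ℂ φ - Matrix.gram ℂ m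
      ).PosSemidef := by
    have := posSemidef_gram_sub_gram_map L (fun y => by
      refine (sq_le_sq₀ (norm_nonneg _) (norm_nonneg _)).1 ?_
      rw [WithLp.prod_norm_sq_eq_of_L2, WithLp.prod_norm_sq_eq_of_L2]
      exact norm_add_smul_sub_inner_sq_le hF y.snd y.fst) fun j => WithLp.toLp 2 (α j, x j)
    convert this using 1
    refine Matrix.ext fun i j => ?_
    simp only [Matrix.sub_apply, Matrix.add_apply, Matrix.gram_apply, WithLp.prod_inner_apply]
    change _ = _ - (⟪m i, m j⟫_ℂ + ⟪φ i, φ j⟫_ℂ)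
    ring
  have hdilation : (Matrix.gram ℂ a ⊙ Matrix.gram ℂ m + Matrix.gram ℂ v - Matrix.gram ℂ x
      ).PosSemidef := by
    have := posSemidef_gram_sub_gram_map (V : _ →ₗ[ℂ] H) (fun y =>
      (V.le_opNorm y).trans (mul_le_of_le_one_left (norm_nonneg _) hV))
      fun j => WithLp.toLp 2 (lpTensor (a j) (m j), v j)
    convert this using 1
    refine Matrix.ext fun i j => ?_
    simp only [Matrix.sub_apply, Matrix.add_apply, Matrix.hadamard_apply, Matrix.gram_apply,
      WithLp.prod_inner_apply, inner_lpTensor, ContinuousLinearMap.coe_coe]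
    rw [← hx i, ← hx j]
  have hcompress : (Matrix.gram ℂ x - Matrix.gram ℂ φ).PosSemidef :=
    posSemidef_gram_sub_gram_map (innerSL ℂ F : H →ₗ[ℂ] ℂ) (fun y => by
      simpa using (norm_inner_le_norm F y).trans (mul_le_of_le_one_left (norm_nonneg _) hF)) x
  have hslack := (posSemidef_gram_of_infinite p).hadamard
    (((posSemidef_gram_of_infinite a).hadamard hdefect).add hdilation)
  have hsum := hslack.add ((posSemidef_gram_of_infinite α).add hcompress)
  refine (congrArg Matrix.PosSemidef (Matrix.ext fun i j => ?_)).mpr hsum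
  simp only [Matrix.sub_apply, Matrix.add_apply, Matrix.hadamard_apply, Matrix.gram_apply]
  change _ * (_ + _ - ⟪φ i, φ j⟫_ℂ) = _
  linear_combination (⟪α i, α j⟫_ℂ + ⟪x i, x j⟫_ℂ - ⟪φ i, φ j⟫_ℂ) * hp i j

end SchurPositivity

/-! ### Multiplier columns and necessity -/

section Columns

variable {Ω : Type*}
  {Hs : Type*} [NormedAddCommGroup Hs] [InnerProductSpace ℂ Hs] [CompleteSpace Hs] [RKHS ℂ Hs Ω ℂ]

/-- A contractive column of multipliers, obtained as the adjoint of the contraction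
`k_w ⊗ e_o ↦ Φ w o • k_w`. -/
theorem exists_multiplier_column (Φ : Ω → Option ℕ → ℂ)
    (h : (Matrix.gram ℂ (fun j : Ω × Option ℕ =>
        (lp.single 2 j.2 (kernelVector Hs j.1) : lp (fun _ : Option ℕ => Hs) 2)) -
      Matrix.gram ℂ fun j : Ω × Option ℕ => Φ j.1 j.2 • kernelVector Hs j.1).PosSemidef) :
    ∃ (ψ : Mult Hs) (φ : ℕ → Mult Hs), (∀ z, ψ.1 z = conj (Φ z none)) ∧
      (∀ n z, (φ n).1 z = conj (Φ z (some n))) ∧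
      ∀ h : Hs, Summable (fun n => ‖(φ n).op h‖ ^ 2) ∧
        ‖ψ.op h‖ ^ 2 + ∑' n, ‖(φ n).op h‖ ^ 2 ≤ ‖h‖ ^ 2 := by
  obtain ⟨R, hR, hRk⟩ := exists_contraction_of_posSemidef_gram_sub_gram _ _ h
  have hval : ∀ (h : Hs) (o : Option ℕ) (z : Ω), R.adjoint h o z = conj (Φ z o) * h z := by
    intro h o z
    have h1 : ⟪(lp.single 2 o (kernelVector Hs z) : lp (fun _ : Option ℕ => Hs) 2),
        R.adjoint h⟫_ℂ = R.adjoint h o z :=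
      (lp.inner_single_left o _ _).trans (inner_kernelVector_left (H := Hs) z _)
    rw [← h1, ContinuousLinearMap.adjoint_inner_right, hRk (z, o), inner_smul_left,
      inner_kernelVector_left]
  let M : Option ℕ → Mult Hs := fun o => ⟨fun z => conj (Φ z o),
    (lp.evalCLM ℂ (fun _ : Option ℕ => Hs) 2 o).comp R.adjoint, fun h z => hval h o z⟩
  have hM : ∀ h o, (M o).op h = R.adjoint h o := fun h o => by
    refine RKHS.ext fun z => ?_
    rw [hval, Mult.op_apply]
  refine ⟨M none, fun n => M (some n), fun _ => rfl, fun _ _ => rfl, fun h => ?_⟩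
  have hfin : ∀ t : Finset ℕ,
      ‖(M none).op h‖ ^ 2 + ∑ n ∈ t, ‖(M (some n)).op h‖ ^ 2 ≤ ‖h‖ ^ 2 := by
    intro t
    have h1 : ∑ o ∈ t.insertNone, ‖R.adjoint h o‖ ^ 2 ≤ ‖R.adjoint h‖ ^ 2 := by
      simpa using lp.sum_rpow_le_norm_rpow (p := 2) (by norm_num) (R.adjoint h) t.insertNone
    have h2 : ‖R.adjoint h‖ ≤ ‖h‖ := by
      refine (R.adjoint.le_opNorm h).trans (mul_le_of_le_one_left (norm_nonneg _) ?_)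
      rwa [LinearIsometryEquiv.norm_map]
    rw [Finset.sum_insertNone] at h1
    simp only [hM]
    exact h1.trans (pow_le_pow_left₀ (norm_nonneg _) h2 2)
  have hsum : Summable fun n => ‖(M (some n)).op h‖ ^ 2 :=
    summable_of_sum_le (fun n => sq_nonneg _) (c := ‖h‖ ^ 2) fun t =>
      (le_add_of_nonneg_left (sq_nonneg _)).trans (hfin t)
  refine ⟨hsum, ?_⟩
  rw [← le_sub_iff_add_le']
  exact hsum.tsum_le_of_sum_le fun t => le_sub_iff_add_le'.2 (hfin t)

/-- A contractive multiplier vanishing at the normalization point never takes the value `1`. -/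
theorem one_sub_multiplier_ne_zero {z₀ : Ω} (hz₀ : ∀ z, scalarKernel Hs z₀ z = 1) (ψ : Mult Hs)
    (hψ : ψ.1 z₀ = 0) (hc : ∀ h : Hs, ‖ψ.op h‖ ≤ ‖h‖) (z : Ω) : 1 - ψ.1 z ≠ 0 := by
  intro h0
  have h1 : ψ.1 z = 1 := (sub_eq_zero.1 h0).symm
  set K := kernelVector Hs z
  -- If `ψ z = 1`, contractivity forces `ψ K = K`, but `K z₀ = 1` while `ψ z₀ = 0`.
  have hin : ⟪K, ψ.op K⟫_ℂ = ⟪K, K⟫_ℂ := by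
    rw [inner_kernelVector_left, inner_kernelVector_left, Mult.op_apply, h1, one_mul]
  have hre : RCLike.re ⟪K, ψ.op K⟫_ℂ = ‖K‖ ^ 2 := by
    rw [hin, inner_self_eq_norm_sq]
  have hsub := norm_sub_sq (𝕜 := ℂ) K (ψ.op K)
  have hle := pow_le_pow_left₀ (norm_nonneg _) (hc K) 2
  have hzero : ‖K - ψ.op K‖ = 0 := by
    refine pow_eq_zero_iff two_ne_zero |>.1 (le_antisymm ?_ (sq_nonneg _))
    rw [hsub, hre]
    linarith
  have heq : K = ψ.op K := sub_eq_zero.1 (norm_eq_zero.1 hzero)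
  have h2 : K z₀ = 1 := by rw [kernelVector_apply, hz₀]
  rw [heq, Mult.op_apply, hψ, zero_mul] at h2
  exact zero_ne_one h2

variable {Hk : Type*} [NormedAddCommGroup Hk] [InnerProductSpace ℂ Hk] [CompleteSpace Hk]
  [RKHS ℂ Hk Ω ℂ]

/-- The multipliers are the conjugated coefficients of the linear map `(α, v) ↦ ⟪F, x⟫` defined by
the fixed point equation. -/
theorem exists_factorization {z₀ : Ω} {u gn : ℕ → Ω → ℂ} (hu₀ : ∀ n, u n z₀ = 0)
    (hu : ∀ z, Summable fun n => ‖conj (u n z)‖ ^ 2)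
    (hs : ∀ z w, scalarKernel Hs z w * (1 - ∑' n, u n z * conj (u n w)) = 1)
    (hg : ∀ z, Summable fun n => ‖conj (gn n z)‖ ^ 2)
    (hk : ∀ z w, scalarKernel Hk z w = scalarKernel Hs z w * ∑' n, gn n z * conj (gn n w))
    (F : Hk) (hF : ‖F‖ ≤ 1) :
    ∃ (ψ : Mult Hs) (φ : ℕ → Mult Hs), ψ.1 z₀ = 0 ∧
      (∀ h : Hs, Summable (fun n => ‖(φ n).op h‖ ^ 2) ∧
        ‖ψ.op h‖ ^ 2 + ∑' n, ‖(φ n).op h‖ ^ 2 ≤ ‖h‖ ^ 2) ∧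
      ∀ z, HasSum (fun n => gn n z * (φ n).1 z) (F z * (1 - ψ.1 z)) := by
  let U : Ω → lp (fun _ : ℕ => ℂ) 2 := fun w => toL2 _ (hu w)
  let G : Ω → lp (fun _ : ℕ => ℂ) 2 := fun w => toL2 _ (hg w)
  have hU : ∀ z w, ⟪kernelVector Hs z, kernelVector Hs w⟫_ℂ * (1 - ⟪U z, U w⟫_ℂ) = 1 := by
    intro z w
    rw [inner_kernelVector, inner_toL2_conj, hs]
  have hU1 : ∀ w, ‖U w‖ < 1 := by
    intro w
    have h1 : ‖kernelVector Hs w‖ ^ 2 * (1 - ‖U w‖ ^ 2) = 1 := by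
      have := hU w w
      rw [inner_self_eq_norm_sq_to_K, inner_self_eq_norm_sq_to_K] at this
      have h2 : ((‖kernelVector Hs w‖ ^ 2 * (1 - ‖U w‖ ^ 2) : ℝ) : ℂ) = 1 := by
        push_cast
        exact this
      exact_mod_cast h2
    by_contra! h
    have h3 : 1 - ‖U w‖ ^ 2 ≤ 0 := by nlinarith
    linarith [mul_nonpos_of_nonneg_of_nonpos (sq_nonneg ‖kernelVector Hs w‖) h3]
  obtain ⟨V, hV, hVk⟩ := exists_contraction_of_inner_eq
    (fun w => WithLp.toLp 2 (lpTensor (U w) (kernelVector Hk w), G w))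
    (fun w => kernelVector Hk w) (by
      intro z w
      rw [WithLp.prod_inner_apply]
      change ⟪lpTensor (U z) (kernelVector Hk z), lpTensor (U w) (kernelVector Hk w)⟫_ℂ +
        ⟪G z, G w⟫_ℂ = _
      rw [inner_lpTensor, inner_kernelVector, hk, inner_toL2_conj, inner_toL2_conj]
      linear_combination (-∑' n, gn n z * conj (gn n w)) * hs z w)
  choose X hX using fun w => exists_fixedPoint_solution hF V hV (hU1 w)
  -- `(α o, v o)` runs through the standard orthonormal basis of `ℂ ⊕ ℓ²`: `none` will yield `ψ` and
  -- `some n` will yield `φ n`.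
  let α : Option ℕ → ℂ := fun o => o.elim 1 fun _ => 0
  let v : Option ℕ → lp (fun _ : ℕ => ℂ) 2 := fun o => o.elim 0 fun n => lp.single 2 n 1
  have horth : ∀ o o', ⟪α o, α o'⟫_ℂ + ⟪v o, v o'⟫_ℂ = if o = o' then 1 else 0 := by
    intro o o'
    rcases o with _ | n <;> rcases o' with _ | n'
    · simp [α, v]
    · simp [α, v]
    · simp [α, v]
    · by_cases hn : n = n'
      · subst hn
        simp [α, v, -lp.single_apply]
      · simp [α, v, lp.inner_single_left, hn]
  let Φ : Ω → Option ℕ → ℂ := fun w o => ⟪F, X w (α o, v o)⟫_ℂ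
  have hpos := posSemidef_kernel_hadamard_sub hF V hV
    (fun j : Ω × Option ℕ => kernelVector Hs j.1) (fun j => U j.1) (fun i j => hU i.1 j.1)
    (fun j => α j.2) (fun j => v j.2) (fun j => X j.1 (α j.2, v j.2))
    (fun j => (hX j.1 (α j.2, v j.2) _).1 rfl)
  obtain ⟨ψ, φ, hψ, hφ, hc⟩ := exists_multiplier_column (Hs := Hs) Φ (by
    refine (congrArg Matrix.PosSemidef (Matrix.ext fun i j => ?_)).mpr hpos
    simp only [Matrix.sub_apply, Matrix.add_apply, Matrix.hadamard_apply, Matrix.gram_apply,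
      horth, lp.inner_single_left, inner_smul_left, inner_smul_right]
    change _ = _ * (_ - Φ j.1 j.2 * conj (Φ i.1 i.2))
    by_cases h : i.2 = j.2
    · rw [if_pos h, h, lp.single_apply_self]
      ring
    · rw [if_neg h, lp.single_apply_ne _ _ _ h, inner_zero_right]
      ring)
  refine ⟨ψ, φ, ?_, hc, fun z => ?_⟩
  · have hU0 : U z₀ = 0 := lp.ext (funext fun n => by simp [U, hu₀])
    have h0 : X z₀ (1, 0) = 0 := by
      refine ((hX z₀ (1, 0) 0).2 ?_).symm
      have : lpTensor (U z₀) ((0 : Hk) + ((1 : ℂ) - ⟪F, (0 : Hk)⟫_ℂ) • F) = 0 := by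
        rw [← norm_eq_zero, norm_lpTensor, hU0, norm_zero, zero_mul]
      rw [this]
      exact (map_zero V).symm
    rw [hψ]
    change conj ⟪F, X z₀ (1, 0)⟫_ℂ = 0
    rw [h0, inner_zero_right, map_zero]
  · let ℓ : (ℂ × lp (fun _ : ℕ => ℂ) 2) →L[ℂ] ℂ := (innerSL ℂ F).comp (X z)
    -- For this input the feedback term vanishes at `x = k_z`, and the equation reduces to the
    -- defining property of `V`.
    have hkX : kernelVector Hk z = X z (conj (F z), G z) := by
      refine (hX z (conj (F z), G z) _).2 ?_
      rw [inner_kernelVector_right, sub_self, zero_smul, add_zero]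
      exact (hVk z).symm
    have hFz : conj (F z) = conj (F z) * ℓ (1, 0) + ℓ (0, G z) := by
      have h1 : conj (F z) = ℓ (conj (F z), G z) := by
        have h3 := inner_kernelVector_right z F
        rw [hkX] at h3
        exact h3.symm
      have h2 : ((conj (F z), G z) : ℂ × lp (fun _ : ℕ => ℂ) 2) =
          conj (F z) • ((1 : ℂ), (0 : lp (fun _ : ℕ => ℂ) 2)) + (0, G z) := by
        refine Prod.ext ?_ ?_ <;> simp
      conv_lhs => rw [h1, h2, map_add, map_smul, smul_eq_mul]
    have hG : HasSum (fun n => conj (gn n z) * ℓ (0, lp.single 2 n 1)) (ℓ (0, G z)) := by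
      have h1 := (lp.hasSum_single ENNReal.ofNat_ne_top (G z)).mapL
        (ℓ.comp (ContinuousLinearMap.inr ℂ ℂ (lp (fun _ : ℕ => ℂ) 2)))
      refine h1.congr_fun fun n => ?_
      have h2 : (lp.single 2 n (G z n) : lp (fun _ : ℕ => ℂ) 2) =
          conj (gn n z) • lp.single 2 n 1 := by
        rw [← lp.single_smul, smul_eq_mul, mul_one]
        rfl
      rw [h2, map_smul]
      rfl
    have hconj := hG.map (starRingEnd ℂ) Complex.continuous_conj
    have hlim : conj (ℓ (0, G z)) = F z * (1 - ψ.1 z) := by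
      have h1 := congrArg conj hFz
      rw [map_add, map_mul, Complex.conj_conj] at h1
      have h2 : ψ.1 z = conj (ℓ (1, 0)) := hψ z
      rw [h2]
      linear_combination -h1
    rw [hlim] at hconj
    convert hconj using 1
    funext n
    simp only [Function.comp_apply, map_mul, Complex.conj_conj]
    rw [hφ]
    rfl

end Columns

/-! ### The characterization of the unit ball -/

theorem corollary3 {Ω : Type*} (z₀ : Ω)
    {Hs : Type*} [NormedAddCommGroup Hs] [InnerProductSpace ℂ Hs] [CompleteSpace Hs]
    [RKHS ℂ Hs Ω ℂ]
    {Hk : Type*} [NormedAddCommGroup Hk] [InnerProductSpace ℂ Hk] [CompleteSpace Hk]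
    [RKHS ℂ Hk Ω ℂ]
    (s k g : Ω → Ω → ℂ) (gn : ℕ → Ω → ℂ)
    (hs : IsNormalizedCNP s z₀)
    (hg : ∀ z w, HasSum (fun n => gn n z * conj (gn n w)) (g z w))
    (hk : ∀ z w, k z w = s z w * g z w)
    (hHs : ∀ z w, scalarKernel Hs z w = s z w)
    (hHk : ∀ z w, scalarKernel Hk z w = k z w)
    (f : Ω → ℂ) :
    InUnitBall Hk f ↔
      ∃ (ψ : Mult Hs) (φ : ℕ → Mult Hs),
        ψ.1 z₀ = 0 ∧
        (∀ h : Hs, Summable (fun n => ‖(φ n).op h‖ ^ 2) ∧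
          ‖ψ.op h‖ ^ 2 + ∑' n, ‖(φ n).op h‖ ^ 2 ≤ ‖h‖ ^ 2) ∧
        ∀ z, 1 - ψ.1 z ≠ 0 ∧ Summable (fun n => gn n z * (φ n).1 z) ∧
          f z = (∑' n, gn n z * (φ n).1 z) / (1 - ψ.1 z) := by
  obtain ⟨-, u, hu₀, hu, hsu⟩ := hs
  have hu' : ∀ z, Summable fun n => ‖conj (u n z)‖ ^ 2 := by simpa using hu
  have hs' : ∀ z w, scalarKernel Hs z w * (1 - ∑' n, u n z * conj (u n w)) = 1 := fun z w => by
    rw [hHs, (hsu z w).2, one_div, inv_mul_cancel₀ (hsu z w).1]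
  have hg' : ∀ z, Summable fun n => ‖conj (gn n z)‖ ^ 2 := fun z =>
    summable_norm_sq_conj_of_hasSum (hg z z)
  have hk' : ∀ z w, scalarKernel Hk z w =
      scalarKernel Hs z w * ∑' n, gn n z * conj (gn n w) := fun z w => by
    rw [hHk, hHs, hk, (hg z w).tsum_eq]
  have hleft : ∀ z, scalarKernel Hs z₀ z = 1 := fun z => by simpa [hu₀] using hs' z₀ z
  have hright : ∀ z, scalarKernel Hs z z₀ = 1 := fun z => by simpa [hu₀] using hs' z z₀
  constructor
  · rintro ⟨F, hFf, hF⟩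
    obtain ⟨ψ, φ, hψ, hc, hsum⟩ := exists_factorization hu₀ hu' hs' hg' hk' F hF
    refine ⟨ψ, φ, hψ, hc, fun z => ?_⟩
    have hne : 1 - ψ.1 z ≠ 0 := by
      refine one_sub_multiplier_ne_zero hleft ψ hψ (fun h => ?_) z
      refine (sq_le_sq₀ (norm_nonneg _) (norm_nonneg _)).1 (le_trans ?_ (hc h).2)
      exact le_add_of_nonneg_right (tsum_nonneg fun n => sq_nonneg _)
    exact ⟨hne, (hsum z).summable, by rw [(hsum z).tsum_eq, hFf, mul_div_cancel_right₀ _ hne]⟩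
  · rintro ⟨ψ, φ, hψ, hc, hf⟩
    obtain ⟨F, hF, hF1⟩ :=
      inUnitBall_div_one_sub hg' hk' hright ψ φ hψ hc fun z => (hf z).1
    exact ⟨F, fun z => (hF z).trans (hf z).2.2.symm, hF1⟩
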